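/- **Setting.** There are $n$ nodes $P_1,\dots,P_n$; a static adversary fixes, before the protocol starts, a set of at most $f<n/3$ Byzantine nodes, which then behave arbitrarily except that they cannot forge signatures, signature shares or threshold certificates, nor find hash collisions (idealised cryptography). Every packet sent is eventually received; the delivery schedule is otherwise arbitrary (in particular it may be random). Honest nodes follow the protocol APM-BRB: in every round $r\ge 1$ a sender $P_i$ sends a message $m_r^i$ to a public committee $N_c(i,r)=\textsc{sampleCommittee}(i,r)$. The message contains the certificate $\mathrm{cert}(m_{r-1}^i)$ of the previous message (if $r>1$), certificates $\mathrm{prev}\{\}$ for messages of round $r-1$ of $2f+1$ nodes, and certificates $\mathrm{triggers}[\,]$ that the sender has processed. An honest committee member signs the first message that it receives for $(i,r)$, provided it extends (by its certificate) the chain of messages of $P_i$ in the member's own memory, and hands it out on request. A certificate $\mathrm{cert}(m_r^i)$ is formed from signature shares of $\lfloor n_c/2\rfloor+1$ members of $N_c(i,r)$. An honest node calls $\textsc{Deliver}_i(m,u)$ in the course of a backward walk: starting from a certificate it repeatedly requests the certified message $m_u^i$ from the members of $N_c(i,u)$, delivers it if it is due and no message of $P_i$ for round $u$ has been delivered, and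 continues with the certificate contained in $m_u^i$. Walks are started (1) from every certificate $\mathrm{cert}(m_r^i)$ with $r\ge\varphi$ that is obtained from shares, from $P_i$, or from the $\mathrm{triggers}[\,]$ of a delivered message, delivering the rounds $r-\varphi,\dots,1$; (2) from every certificate $\mathrm{cert}(m_{r-1}^i)$ that occurs in $\mathrm{prev}\{\}$ of a certified round-$r$ message of each of the $n$ nodes, or in $\mathrm{prev}\{\}$ of the delivered round-$r$ messages of $2f+1$ nodes, delivering the rounds $r-1,\dots,1$. **Parameters.** $\varepsilon>0$, $\varphi\ge 1$ and $n_c\ge 18\ln(\varphi/\varepsilon)$ (in particular $\varphi$ may be $2n\ln(1/\varepsilon)$, rounded to an integer). For each sender $P_j$ and each residue of the round modulo $\varphi$, the committee is a uniformly random set of $n_c$ nodes; $N_c(j,r)$ depends on $r$ only modulo $\varphi$. **Lemma (APM-BRB satisfies Completion Sequentiality).** Let $P_i$ be a designated sender. With probability at least $1-\varepsilon$ the following holds for every honest node $P_j$ and every round $r>1$: if $P_j$ calls $\textsc{Deliver}_i(m,r)$ for some $m$, then eventually $P_j$ has called $\textsc{Deliver}_i(m'',r-1)$ for some $m''$. Moreover,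 the certificate contained in $m$ is then the certificate of a message $m'$ of $P_i$ for round $r-1$, and $P_j$ eventually has requested the round-$(r-1)$ message of $P_i$ from all members of the public committee $N_c(i,r-1)$ and received $m'$ from one of them. -/

import Mathlib

open MeasureTheory

namespace APMBRB

/-- An (ideal) threshold certificate: the unique threshold signature, under the key of the
committee of `sender` in `round`, on the digest `digest`. It carries the digest only, so a node that
holds a certificate still has to obtain the certified message. Strings that are not valid
certificates are represented by `none` wherever a certificate is expected. -/
structure Cert (n : ℕ) (D : Type*) where
  sender : Fin n
  round : ℕ
  digest : D

/-- A protocol message `m_r^i` (with `i = sender`, `r = round`): its content, the certificate of the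
sender's message of the previous round, the array `prev` of certificates of other nodes in the
previous round, and the array `triggers`. -/
structure Msg (n : ℕ) (P D : Type*) where
  sender : Fin n
  round : ℕ
  content : P
  parent : Option (Cert n D)
  prev : Fin n → Option (Cert n D)
  triggers : Fin n → Option (Cert n D)

/-- What is sent over the network: broadcast (or re-sent) messages, signature shares of `signer`,
certificates, requests for the message of `sender` in `round` (with or without its certificate),
and responses to requests. -/
inductive Payload (n : ℕ) (P D : Type*) where
  | msg (m : Msg n P D)
  | share (signer : Fin n) (c : Cert n D)
  | cert (c : Cert n D)
  | request (sender : Fin n) (round : ℕ) (wantCert : Bool)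
  | response (m : Msg n P D)

/-- A position of a backward walk along a chain of certificates: the next message to obtain is the
one certified by `cert`, and messages are delivered from round `top` downwards. -/
structure Walk (n : ℕ) (D : Type*) where
  cert : Cert n D
  top : ℕ

/-- The parameters of a protocol instance: the resilience `f`, the committee size `nc`, the period
`φ` of the committees, the (static) set `byz` of Byzantine nodes, the hash function, and the content
that each node wants to broadcast in each round. -/
structure Setup (n : ℕ) (P D : Type*) where
  f : ℕ
  nc : ℕ
  φ : ℕ
  byz : Finset (Fin n)
  hash : Msg n P D → D
  input : Fin n → ℕ → P

/-- The local state of a node. -/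
structure LocalState (n : ℕ) (P D : Type*) where
  /-- packets received, with their source -/
  rcvd : Set (Fin n × Payload n P D)
  /-- packets sent, with their destination -/
  out : Set (Fin n × Payload n P D)
  /-- the node's own broadcast message of each round -/
  own : ℕ → Option (Msg n P D)
  /-- the first message received as a committee member, for each sender and round -/
  accepted : Fin n → ℕ → Option (Msg n P D)
  /-- the messages on which the node has issued a signature share -/
  signed : Set (Msg n P D)
  /-- `promises j` lists consecutive messages of `j`, of rounds `1, 2, 3, …` -/
  promises : Fin n → List (Msg n P D)
  /-- calls of `fetchMsg`, as (sender, round, useCommittee) -/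
  fetches : Set (Fin n × ℕ × Bool)
  /-- for each round `y`, the nodes `j` whose `reqMsg(y, j)` has completed, in order of completion -/
  reqDone : ℕ → List (Fin n)
  /-- certificates obtained -/
  certs : Set (Cert n D)
  triggers : Fin n → Option (Cert n D)
  /-- messages collected for the second deliver condition -/
  collected : Set (Msg n P D)
  /-- positions reached by backward walks -/
  walks : Set (Walk n D)
  /-- positions whose message has been obtained and dealt with -/
  walked : Set (Walk n D)
  /-- the messages `m` for which `Deliver_i(m, r)`, `i = m.sender`, `r = m.round`, was called -/
  delivered : Set (Msg n P D)

/-- The state of every node at the start. -/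
def LocalState.empty (n : ℕ) (P D : Type*) : LocalState n P D where
  rcvd := ∅
  out := ∅
  own := fun _ => none
  accepted := fun _ _ => none
  signed := ∅
  promises := fun _ => []
  fetches := ∅
  reqDone := fun _ => []
  certs := ∅
  triggers := fun _ => none
  collected := ∅
  walks := ∅
  walked := ∅
  delivered := ∅

section Protocol

variable {n : ℕ} {P D : Type*}

/-- `cert(m)`. -/
def Setup.certOf (S : Setup n P D) (m : Msg n P D) : Cert n D :=
  ⟨m.sender, m.round, S.hash m⟩

/-- The number of shares needed for a certificate: a simple majority of a committee. -/
def Setup.threshold (S : Setup n P D) : ℕ := S.nc / 2 + 1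

/-- The public function `sampleCommittee(i, r)`. The table `N` holds the committee drawn for each
sender and each residue of the round modulo `φ`. -/
def Setup.committee (S : Setup n P D) (N : Fin n → ℕ → Finset (Fin n)) (i : Fin n) (r : ℕ) :
    Finset (Fin n) :=
  N i (r % S.φ)

/-- The entry `promises[j][y]`, for `y ≥ 1`. -/
def LocalState.promise (L : LocalState n P D) (j : Fin n) (y : ℕ) : Option (Msg n P D) :=
  (L.promises j)[y - 1]?

/-- Send `x` to all nodes in `dsts`. -/
def LocalState.send (L : LocalState n P D) (dsts : Finset (Fin n)) (x : Payload n P D) :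
    LocalState n P D :=
  { L with out := L.out ∪ {q | q.1 ∈ dsts ∧ q.2 = x} }

/-- `x` has been sent to all nodes in `dsts`. -/
def LocalState.hasSent (L : LocalState n P D) (dsts : Finset (Fin n)) (x : Payload n P D) : Prop :=
  ∀ q ∈ dsts, (q, x) ∈ L.out

/-- Start (or continue) a backward walk at position `w`. -/
def LocalState.startWalk (L : LocalState n P D) (w : Walk n D) : LocalState n P D :=
  { L with walks := insert w L.walks }

/-- The messages that a node can hand out on request: those it has signed, those in its promises,
and its own. -/
def LocalState.Holds (L : LocalState n P D) (m : Msg n P D) : Prop :=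
  m ∈ L.signed ∨ m ∈ L.promises m.sender ∨ L.own m.round = some m

/-- A certificate of round `r` has been obtained for every node. -/
def LocalState.hasAllCerts (L : LocalState n P D) (r : ℕ) : Prop :=
  ∀ j, ∃ c ∈ L.certs, c.sender = j ∧ c.round = r

open Classical in
/-- `processCertificate(i, r, c)`, where `i = c.sender`, `r = c.round`: if `r ≥ φ`, update
`triggers[i]` and start to walk back from `c`, delivering from round `r - φ` on. -/
noncomputable def Setup.processCertificate (S : Setup n P D) (c : Cert n D)
    (L : LocalState n P D) : LocalState n P D :=
  let L₁ : LocalState n P D := { L with certs := insert c L.certs }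
  if S.φ ≤ c.round then
    let L₂ : LocalState n P D :=
      if ∀ d, L.triggers c.sender = some d → d.round < c.round then
        { L₁ with triggers := Function.update L.triggers c.sender (some c) }
      else L₁
    L₂.startWalk ⟨c, c.round - S.φ⟩
  else L₁

open Classical in
/-- `Deliver_i(m, r)`, where `i = m.sender`, `r = m.round`, if no message of `i` for round `r` has
been delivered already; then all certificates in `m.triggers` are processed. -/
noncomputable def Setup.deliver (S : Setup n P D) (m : Msg n P D)
    (L : LocalState n P D) : LocalState n P D :=
  if ∃ m' ∈ L.delivered, m'.sender = m.sender ∧ m'.round = m.round then L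
  else
    (List.finRange n).foldl
      (fun K j =>
        match m.triggers j with
        | some c => if c.sender = j then S.processCertificate c K else K
        | none => K)
      { L with delivered := insert m L.delivered }

open Classical in
/-- The message that node `k` broadcasts in round `r`. -/
noncomputable def Setup.newMsg (S : Setup n P D) (k : Fin n) (r : ℕ) (L : LocalState n P D) :
    Msg n P D where
  sender := k
  round := r
  content := S.input k r
  parent := if r = 1 then none else (L.own (r - 1)).map S.certOf
  prev := fun j =>
    if r ≠ 1 ∧ j ∈ (L.reqDone (r - 1)).take (2 * S.f + 1) then
      (L.promise j (r - 1)).map S.certOf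
    else none
  triggers := L.triggers

/-- The atomic actions of the protocol at a node. -/
inductive Action (n : ℕ) (P D : Type*) where
  /-- the sender starts `reqMsg(r - 1, j)` for all `j` -/
  | startReq (r : ℕ)
  /-- `reqMsg(y, j)` completes -/
  | finishReq (j : Fin n) (y : ℕ)
  /-- the sender broadcasts its message of round `r` to the committee -/
  | broadcast (r : ℕ)
  /-- a committee member receives a message for the first time, and calls `syncMsg` -/
  | accept (src : Fin n) (m : Msg n P D)
  /-- a committee member signs an accepted message that extends its promises -/
  | sign (m : Msg n P D)
  /-- a running `fetchMsg(r, i, b)` requests its next message -/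
  | fetchRequest (i : Fin n) (r : ℕ) (b : Bool)
  /-- a running `reqMsg(r, i)` whose message is there already requests the certificate -/
  | fetchCert (i : Fin n) (r : ℕ)
  /-- a running `fetchMsg(r, i, b)` stores its next message `m`, received from `src` -/
  | fetchStore (i : Fin n) (r : ℕ) (b : Bool) (src : Fin n) (m : Msg n P D)
  /-- reply to a request -/
  | reply (dst : Fin n) (b : Bool) (m : Msg n P D)
  /-- reply to a request for the certificate of a message of one's own -/
  | replyCert (dst : Fin n) (m : Msg n P D)
  /-- obtain a certificate from signature shares or from the sender (deliver condition 1) -/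
  | obtainCert (c : Cert n D)
  /-- request the message to be obtained at position `w` of a backward walk -/
  | walkRequest (w : Walk n D)
  /-- obtain that message `m` from `src`, deliver it if due, and walk on -/
  | walkStep (w : Walk n D) (src : Fin n) (m : Msg n P D)
  /-- all certificates of round `r` being there, request the message of `j` -/
  | collectRequest (j : Fin n) (r : ℕ)
  /-- collect such a message -/
  | collect (src : Fin n) (m : Msg n P D)
  /-- deliver condition 2, all `n` messages of a round refer to `c` -/
  | deliverAll (c : Cert n D)
  /-- deliver condition 2, the delivered messages of `2f + 1` nodes refer to `c` -/
  | deliverQuorum (c : Cert n D) (Q : Finset (Fin n))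

/-- To whom `fetchMsg(·, i, b)` addresses its request for the message of round `y`. -/
def Setup.fetchTargets (S : Setup n P D) (N : Fin n → ℕ → Finset (Fin n)) (i : Fin n) (b : Bool)
    (y : ℕ) : Finset (Fin n) :=
  if b then S.committee N i y else {i}

/-- The request of `fetchMsg(r, i, b)` for the message of round `y`; only the last request of
`reqMsg` asks for a certificate of the message itself. -/
def fetchPayload (P D : Type*) (i : Fin n) (r : ℕ) (b : Bool) (y : ℕ) : Payload n P D :=
  .request i y (!b && decide (y = r))

open Classical in
/-- When node `k` may take an action. -/
def Setup.Enabled (S : Setup n P D) (N : Fin n → ℕ → Finset (Fin n)) (k : Fin n)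
    (L : LocalState n P D) : Action n P D → Prop
  | .startReq r => 2 ≤ r ∧ L.own (r - 1) ≠ none ∧ ∃ j, (j, r - 1, false) ∉ L.fetches
  | .finishReq j y =>
      (j, y, false) ∈ L.fetches ∧ j ∉ L.reqDone y ∧
        ∃ m, L.promise j y = some m ∧ S.certOf m ∈ L.certs
  | .broadcast r =>
      L.own r = none ∧
        (r = 1 ∨
          (2 ≤ r ∧ (∃ m, L.own (r - 1) = some m ∧ S.certOf m ∈ L.certs) ∧
            2 * S.f + 1 ≤ (L.reqDone (r - 1)).length))
  | .accept src m =>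
      (src, .msg m) ∈ L.rcvd ∧ 1 ≤ m.round ∧ k ∈ S.committee N m.sender m.round ∧
        L.accepted m.sender m.round = none
  | .sign m =>
      L.accepted m.sender m.round = some m ∧ m ∉ L.signed ∧
        (m.round = 1 ∨
          ∃ p, L.promise m.sender (m.round - 1) = some p ∧ m.parent = some (S.certOf p))
  | .fetchRequest i r b =>
      (i, r, b) ∈ L.fetches ∧ (L.promises i).length < r ∧
        ¬ L.hasSent (S.fetchTargets N i b ((L.promises i).length + 1))
          (fetchPayload P D i r b ((L.promises i).length + 1))
  | .fetchCert i r =>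
      (i, r, false) ∈ L.fetches ∧ (∃ m, L.promise i r = some m ∧ S.certOf m ∉ L.certs) ∧
        ¬ L.hasSent {i} (.request i r true)
  | .fetchStore i r b src m =>
      (i, r, b) ∈ L.fetches ∧ (L.promises i).length < r ∧
        m.sender = i ∧ m.round = (L.promises i).length + 1 ∧
        src ∈ S.fetchTargets N i b m.round ∧ (src, .response m) ∈ L.rcvd ∧
        (m.round = 1 ∨ ∃ p, L.promise i (m.round - 1) = some p ∧ m.parent = some (S.certOf p)) ∧
        (m.round = r ∧ b = false → S.certOf m ∈ L.certs)
  | .reply dst b m =>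
      (dst, .request m.sender m.round b) ∈ L.rcvd ∧ L.Holds m ∧ (dst, .response m) ∉ L.out
  | .replyCert dst m =>
      (dst, .request k m.round true) ∈ L.rcvd ∧ L.own m.round = some m ∧ S.certOf m ∈ L.certs ∧
        (dst, .cert (S.certOf m)) ∉ L.out
  | .obtainCert c =>
      c ∉ L.certs ∧
        (S.threshold ≤ ((S.committee N c.sender c.round).filter
            (fun q => ∃ src, (src, .share q c) ∈ L.rcvd)).card ∨
          (c.sender, .cert c) ∈ L.rcvd)
  | .walkRequest w =>
      w ∈ L.walks ∧ w ∉ L.walked ∧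
        ¬ L.hasSent (S.committee N w.cert.sender w.cert.round)
          (.request w.cert.sender w.cert.round false)
  | .walkStep w src m =>
      w ∈ L.walks ∧ w ∉ L.walked ∧
        L.hasSent (S.committee N w.cert.sender w.cert.round)
          (.request w.cert.sender w.cert.round false) ∧
        src ∈ S.committee N w.cert.sender w.cert.round ∧
        (src, .response m) ∈ L.rcvd ∧ S.certOf m = w.cert
  | .collectRequest j r =>
      L.hasAllCerts r ∧ ¬ L.hasSent (S.committee N j r) (.request j r false)
  | .collect src m =>
      L.hasAllCerts m.round ∧ src ∈ S.committee N m.sender m.round ∧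
        (src, .response m) ∈ L.rcvd ∧ S.certOf m ∈ L.certs ∧ m ∉ L.collected
  | .deliverAll c =>
      1 ≤ c.round ∧
        (∀ j, ∃ m ∈ L.collected,
          m.sender = j ∧ m.round = c.round + 1 ∧ m.prev c.sender = some c) ∧
        ⟨c, c.round⟩ ∉ L.walks
  | .deliverQuorum c Q =>
      1 ≤ c.round ∧ Q.card = 2 * S.f + 1 ∧
        (∀ j ∈ Q, ∃ m ∈ L.delivered,
          m.sender = j ∧ m.round = c.round + 1 ∧ m.prev c.sender = some c) ∧
        ⟨c, c.round⟩ ∉ L.walks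

open Classical in
/-- The effect of an action on the state of node `k`. -/
noncomputable def Setup.effect (S : Setup n P D) (N : Fin n → ℕ → Finset (Fin n)) (k : Fin n)
    (L : LocalState n P D) : Action n P D → LocalState n P D
  | .startReq r => { L with fetches := L.fetches ∪ {q | q.2 = (r - 1, false)} }
  | .finishReq j y => { L with reqDone := Function.update L.reqDone y (L.reqDone y ++ [j]) }
  | .broadcast r =>
      let m := S.newMsg k r L
      { L with own := Function.update L.own r (some m) }.send (S.committee N k r) (.msg m)
  | .accept _ m =>
      { L with
        accepted := Function.update L.accepted m.sender
          (Function.update (L.accepted m.sender) m.round (some m))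
        fetches := insert (m.sender, m.round - 1, true) L.fetches }
  | .sign m =>
      ({ L with signed := insert m L.signed }.send
        (S.committee N m.sender m.round) (.msg m)).send Finset.univ (.share k (S.certOf m))
  | .fetchRequest i r b =>
      L.send (S.fetchTargets N i b ((L.promises i).length + 1))
        (fetchPayload P D i r b ((L.promises i).length + 1))
  | .fetchCert i r => L.send {i} (.request i r true)
  | .fetchStore i _ _ _ m =>
      { L with promises := Function.update L.promises i (L.promises i ++ [m]) }
  | .reply dst _ m => L.send {dst} (.response m)
  | .replyCert dst m => L.send {dst} (.cert (S.certOf m))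
  | .obtainCert c => S.processCertificate c L
  | .walkRequest w =>
      L.send (S.committee N w.cert.sender w.cert.round)
        (.request w.cert.sender w.cert.round false)
  | .walkStep w _ m =>
      let L₁ : LocalState n P D := if w.cert.round ≤ w.top then S.deliver m L else L
      let L₂ : LocalState n P D := { L₁ with walked := insert w L₁.walked }
      match m.parent with
      | some c =>
          if c.sender = w.cert.sender ∧ 1 ≤ c.round ∧ c.round + 1 = w.cert.round then
            L₂.startWalk ⟨c, w.top⟩
          else L₂
      | none => L₂
  | .collectRequest j r => L.send (S.committee N j r) (.request j r false)
  | .collect _ m => { L with collected := insert m L.collected }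
  | .deliverAll c => L.startWalk ⟨c, c.round⟩
  | .deliverQuorum c _ => L.startWalk ⟨c, c.round⟩

/-- Node `j` is able to contribute a signature share for the certificate `c`: it is Byzantine, or it
has issued that share. -/
def Setup.ShareIssued (S : Setup n P D) (s : Fin n → LocalState n P D) (j : Fin n)
    (c : Cert n D) : Prop :=
  j ∈ S.byz ∨ ∃ m ∈ (s j).signed, S.certOf m = c

open Classical in
/-- Enough members of the committee have issued shares for `c` to be formed. -/
def Setup.CertFormable (S : Setup n P D) (N : Fin n → ℕ → Finset (Fin n))
    (s : Fin n → LocalState n P D) (c : Cert n D) : Prop :=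
  S.threshold ≤
    ((S.committee N c.sender c.round).filter (fun j => S.ShareIssued s j c)).card

/-- A message can be produced by the adversary: if its sender is honest, the sender has broadcast it
(it bears the sender's digital signature), and none of its certificates is forged. -/
def Setup.MsgFormable (S : Setup n P D) (N : Fin n → ℕ → Finset (Fin n))
    (s : Fin n → LocalState n P D) (m : Msg n P D) : Prop :=
  (m.sender ∉ S.byz → (s m.sender).own m.round = some m) ∧
  (∀ c, m.parent = some c → S.CertFormable N s c) ∧
  (∀ j c, m.prev j = some c → S.CertFormable N s c) ∧
  (∀ j c, m.triggers j = some c → S.CertFormable N s c)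

/-- What a Byzantine node is able to send: anything that does not require to forge a signature, a
signature share or a certificate. -/
def Setup.AdversarySendable (S : Setup n P D) (N : Fin n → ℕ → Finset (Fin n))
    (s : Fin n → LocalState n P D) : Payload n P D → Prop
  | .msg m => S.MsgFormable N s m
  | .share j c => S.ShareIssued s j c
  | .cert c => S.CertFormable N s c
  | .request _ _ _ => True
  | .response m => S.MsgFormable N s m

/-- The events of an execution. -/
inductive Event (n : ℕ) (P D : Type*) where
  /-- honest node `k` takes an action -/
  | act (k : Fin n) (a : Action n P D)
  /-- the network hands a packet to its destination -/
  | receive (src dst : Fin n) (x : Payload n P D)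
  /-- Byzantine node `b` sends a packet -/
  | corrupt (b dst : Fin n) (x : Payload n P D)
  | idle

/-- The transitions of the system. -/
def Setup.Step (S : Setup n P D) (N : Fin n → ℕ → Finset (Fin n))
    (s s' : Fin n → LocalState n P D) : Event n P D → Prop
  | .act k a =>
      k ∉ S.byz ∧ S.Enabled N k (s k) a ∧ s' = Function.update s k (S.effect N k (s k) a)
  | .receive src dst x =>
      (dst, x) ∈ (s src).out ∧
        s' = Function.update s dst { s dst with rcvd := insert (src, x) (s dst).rcvd }
  | .corrupt b dst x =>
      b ∈ S.byz ∧ S.AdversarySendable N s x ∧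
        s' = Function.update s b { s b with out := insert (dst, x) (s b).out }
  | .idle => s' = s

/-- An infinite sequence of global states and of the events between them. -/
structure Execution (n : ℕ) (P D : Type*) where
  state : ℕ → Fin n → LocalState n P D
  event : ℕ → Event n P D

/-- `E` is an execution of APM-BRB with the committees `N`: honest nodes follow the protocol,
Byzantine nodes behave arbitrarily, honest nodes do not stop (an action that stays possible forever
is taken at some time), and every packet sent is received at some time, however late. -/
structure Setup.IsExecution (S : Setup n P D) (N : Fin n → ℕ → Finset (Fin n))
    (E : Execution n P D) : Prop where
  start : E.state 0 = fun _ => LocalState.empty n P D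
  step : ∀ t, S.Step N (E.state t) (E.state (t + 1)) (E.event t)
  progress : ∀ k, k ∉ S.byz → ∀ a t, (∀ t' ≥ t, S.Enabled N k (E.state t' k) a) →
    ∃ t' ≥ t, E.event t' = .act k a
  network : ∀ t src dst x, (dst, x) ∈ (E.state t src).out →
    ∃ t', (src, x) ∈ (E.state t' dst).rcvd

/-- Completion Sequentiality for the designated sender `i`: if an honest node calls
`Deliver_i(·, r)` with `r > 1`, then eventually it has called `Deliver_i(·, r - 1)`. -/
def Setup.CompletionSequentiality (S : Setup n P D) (E : Execution n P D) (i : Fin n) : Prop :=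
  ∀ k, k ∉ S.byz → ∀ t, ∀ m ∈ (E.state t k).delivered, m.sender = i → 1 < m.round →
    ∃ t' ≥ t, ∃ m' ∈ (E.state t' k).delivered, m'.sender = i ∧ m'.round = m.round - 1

/-- How this comes about: whenever an honest node has delivered a message `m` of `i` for a round
`r > 1`, the certificate in `m` is the certificate of a message of `i` for round `r - 1`; eventually
the node has asked all members of `sampleCommittee(i, r - 1)` for the message of that round, and has
received the certified message from one of them. -/
def Setup.ChainRetrieval (S : Setup n P D) (N : Fin n → ℕ → Finset (Fin n))
    (E : Execution n P D) (i : Fin n) : Prop :=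
  ∀ k, k ∉ S.byz → ∀ t, ∀ m ∈ (E.state t k).delivered, m.sender = i → 1 < m.round →
    ∃ m', m'.sender = i ∧ m'.round = m.round - 1 ∧ m.parent = some (S.certOf m') ∧
      ∃ t' ≥ t,
        (E.state t' k).hasSent (S.committee N i (m.round - 1))
          (.request i (m.round - 1) false) ∧
        ∃ src ∈ S.committee N i (m.round - 1), (src, .response m') ∈ (E.state t' k).rcvd

end Protocol

/-- `X` is a uniformly random set of `nc` nodes, sampled without replacement. -/
def IsUniformCommittee {Ω : Type*} [MeasurableSpace Ω] (μ : Measure Ω) {n : ℕ} (nc : ℕ)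
    (X : Ω → Finset (Fin n)) : Prop :=
  ∀ A : Finset (Fin n), MeasurableSet {ω | X ω = A} ∧
    μ {ω | X ω = A} = if A.card = nc then ((n.choose nc : ℕ) : ENNReal)⁻¹ else 0

end APMBRB

/-! The probability enters only through the event that some committee of the designated sender has
more than `nc / 2` Byzantine members. Fewer than a third of the nodes are Byzantine, so a Chernoff
argument with weight `2 ^ |A ∩ B|` bounds the chance for one committee by `exp (-nc / 18)`.
Committees repeat with period `φ`, and a union bound over the residues gives `ε`
(`measure_exists_majority_le`). Off this event the claim holds for every execution, whatever the
schedule and the adversary (`Setup.IsExecution.sequentiality`).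

The deterministic argument uses two invariants. `LocalGenuine`: every certificate in circulation is
backed by enough issued shares, and an honest signer signs a message of round `r > 1` only if its
parent certifies a message of round `r - 1` of the same sender. `WalkSound`: a delivered message was
found by a walk that moves on to any well-formed parent certificate.

Let `m` be delivered. Its certificate is genuine, so some honest committee member signed a message
with this certificate, and injectivity of the hash makes that message `m`. Hence the parent of `m`
is `certOf p` with `p` in the previous round, and the walk reaches it (`exists_previous`). This
certificate is genuine too, so an honest member signed `p` and can hand it out. By fairness and
eventual receipt the request is sent, answered and processed (`eventually_walked`), and the round of
`p` is then delivered because it lies below the top of the walk. -/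

namespace APMBRB

/-! ### Committees with a Byzantine majority are rare -/

open Finset in
/-- The sets of a given size that contain `T`. -/
theorem card_filter_superset {n : ℕ} (c : ℕ) (T : Finset (Fin n)) (hT : T.card ≤ c) :
    ((powersetCard c (univ : Finset (Fin n))).filter (T ⊆ ·)).card =
      (n - T.card).choose (c - T.card) := by
  have h : (n - T.card).choose (c - T.card) = (powersetCard (c - T.card) Tᶜ).card := by
    rw [card_powersetCard, card_compl, Fintype.card_fin]
  rw [h]
  refine card_nbij' (fun A => A \ T) (fun A => A ∪ T) ?_ ?_ ?_ ?_
  · intro A hA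
    simp only [mem_coe, mem_filter, mem_powersetCard] at hA ⊢
    refine ⟨fun x hx => by simp at hx ⊢; exact hx.2, ?_⟩
    rw [card_sdiff_of_subset hA.2, hA.1.2]
  · intro A hA
    simp only [mem_coe, mem_filter, mem_powersetCard] at hA ⊢
    have hd : Disjoint A T := by
      rw [← subset_compl_iff_disjoint_right]; exact hA.1
    refine ⟨⟨subset_univ _, ?_⟩, subset_union_right⟩
    rw [card_union_of_disjoint hd, hA.2]; omega
  · intro A hA
    simp only [mem_coe, mem_filter] at hA
    exact sdiff_union_of_subset hA.2
  · intro A hA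
    simp only [mem_coe, mem_powersetCard] at hA
    have hd : Disjoint A T := by
      rw [← subset_compl_iff_disjoint_right]; exact hA.1
    exact union_sdiff_cancel_right hd

/-- Factor by factor, `3 * (b - j) ≤ n - j`: drawing without replacement from a third only lowers
the chance of the next hit. Truncated subtraction does no harm. -/
theorem descFactorial_mul_three_pow_le {b n : ℕ} (h : 3 * b ≤ n) (j : ℕ) :
    b.descFactorial j * 3 ^ j ≤ n.descFactorial j := by
  induction j with
  | zero => simp
  | succ j ih =>
    rw [Nat.descFactorial_succ, Nat.descFactorial_succ, pow_succ]
    calc (b - j) * b.descFactorial j * (3 ^ j * 3)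
        = ((b - j) * 3) * (b.descFactorial j * 3 ^ j) := by ring
      _ ≤ (n - j) * n.descFactorial j := Nat.mul_le_mul (by omega) ih

theorem choose_mul_three_pow_le {b n : ℕ} (h : 3 * b ≤ n) (j : ℕ) :
    b.choose j * 3 ^ j ≤ n.choose j := by
  have := descFactorial_mul_three_pow_le h j
  rw [Nat.descFactorial_eq_factorial_mul_choose, Nat.descFactorial_eq_factorial_mul_choose,
    mul_assoc] at this
  exact Nat.le_of_mul_le_mul_left this (Nat.factorial_pos j)

open Finset in
/-- The generating function at `2` of a hypergeometric variable, compared with that of the binomial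
variable with success probability `1/3`. -/
theorem sum_two_pow_card_inter_le {n : ℕ} (c : ℕ) (B : Finset (Fin n)) (hB : 3 * B.card ≤ n) :
    ∑ A ∈ powersetCard c (univ : Finset (Fin n)), (2 : ℝ) ^ (A ∩ B).card ≤
      n.choose c * (4 / 3 : ℝ) ^ c := by
  rcases lt_or_ge n c with hcn | hcn
  · rw [powersetCard_eq_empty.2 (by simpa using hcn), sum_empty]
    positivity
  -- The power of two counts the subsets `T` of `A ∩ B`; exchanging the sums leaves, for each `T ⊆
  -- B`, the number of `c`-sets containing `T`.
  have h1 : ∀ A : Finset (Fin n), (2 : ℝ) ^ (A ∩ B).card =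
      ∑ T ∈ B.powerset, if T ⊆ A then (1 : ℝ) else 0 := by
    intro A
    rw [← sum_filter, sum_const, nsmul_eq_mul, mul_one]
    have : B.powerset.filter (· ⊆ A) = (A ∩ B).powerset := by
      ext T; rw [mem_filter, mem_powerset, mem_powerset, subset_inter_iff, and_comm]
    rw [this, card_powerset]; simp
  simp_rw [h1]
  rw [sum_comm]
  have h2 : ∀ T ∈ B.powerset,
      (∑ A ∈ powersetCard c (univ : Finset (Fin n)), if T ⊆ A then (1 : ℝ) else 0) =
        if T.card ≤ c then (((n - T.card).choose (c - T.card) : ℕ) : ℝ) else 0 := by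
    intro T _
    rw [← sum_filter, sum_const, nsmul_eq_mul, mul_one]
    split_ifs with hT
    · rw [card_filter_superset c T hT]
    · rw [Nat.cast_eq_zero, card_eq_zero, filter_eq_empty_iff]
      intro A hA hTA
      rw [mem_powersetCard] at hA
      exact hT (hA.2 ▸ card_le_card hTA)
  rw [sum_congr rfl h2, sum_powerset_apply_card
    (fun j => if j ≤ c then (((n - j).choose (c - j) : ℕ) : ℝ) else 0)]
  -- The hypergeometric factorial moment is compared termwise with the binomial one; the terms on
  -- the right sum to `(1 + 1/3) ^ c` times `n.choose c`.
  have h3 : ∀ j, (B.card.choose j) • (if j ≤ c then (((n - j).choose (c - j) : ℕ) : ℝ) else 0) ≤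
      if j ≤ c then (n.choose c : ℝ) * (c.choose j * (1 / 3 : ℝ) ^ j) else 0 := by
    intro j
    split_ifs with hj
    · have e : (n.choose c : ℝ) * c.choose j = n.choose j * (n - j).choose (c - j) := by
        exact_mod_cast Nat.choose_mul hj
      have l : (B.card.choose j : ℝ) * 3 ^ j ≤ n.choose j := by
        exact_mod_cast choose_mul_three_pow_le hB j
      rw [nsmul_eq_mul, ← mul_assoc, e]
      have l' : (B.card.choose j : ℝ) ≤ n.choose j * (1 / 3 : ℝ) ^ j := by
        rw [one_div, inv_pow, ← div_eq_mul_inv, le_div_iff₀ (by positivity)]; exact l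
      calc (B.card.choose j : ℝ) * ((n - j).choose (c - j) : ℕ)
          ≤ (n.choose j * (1 / 3 : ℝ) ^ j) * ((n - j).choose (c - j) : ℕ) := by gcongr
        _ = _ := by ring
    · simp
  refine (sum_le_sum fun j _ => h3 j).trans ?_
  rw [← sum_filter]
  have h4 : (n.choose c : ℝ) * (4 / 3 : ℝ) ^ c =
      ∑ j ∈ range (c + 1), (n.choose c : ℝ) * (c.choose j * (1 / 3 : ℝ) ^ j) := by
    rw [← mul_sum, show (4 / 3 : ℝ) = 1 / 3 + 1 by norm_num, add_pow]
    simp [mul_comm]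
  rw [h4]
  refine sum_le_sum_of_subset_of_nonneg ?_ (fun _ _ _ => by positivity)
  intro j hj
  simp only [mem_filter, mem_range] at hj ⊢
  omega

open Finset in
/-- Few sets of size `c` have a majority in a set of at most a third of all nodes. -/
theorem card_bad_committees_le {n : ℕ} (c : ℕ) (B : Finset (Fin n)) (hB : 3 * B.card ≤ n) :
    (((powersetCard c (univ : Finset (Fin n))).filter (fun A => c / 2 < (A ∩ B).card)).card : ℝ) ≤
      Real.exp (-(c / 18 : ℝ)) * n.choose c := by
  have hs : (0 : ℝ) < Real.sqrt 2 := by positivity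
  -- Markov's inequality for the weight `2 ^ |A ∩ B|`, which is at least `√2 ^ c` on every bad set;
  -- the rounding in `c / 2` still gives `c ≤ 2 * |A ∩ B|`.
  have h1 : (((powersetCard c (univ : Finset (Fin n))).filter
      (fun A => c / 2 < (A ∩ B).card)).card : ℝ) * Real.sqrt 2 ^ c ≤
        n.choose c * (4 / 3 : ℝ) ^ c := by
    refine le_trans ?_ (sum_two_pow_card_inter_le c B hB)
    rw [← nsmul_eq_mul, ← sum_const]
    refine (sum_le_sum ?_).trans
      (sum_le_sum_of_subset_of_nonneg (filter_subset _ _) (fun _ _ _ => by positivity))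
    intro A hA
    rw [mem_filter] at hA
    calc Real.sqrt 2 ^ c ≤ Real.sqrt 2 ^ (2 * (A ∩ B).card) :=
          pow_le_pow_right₀ (Real.one_le_sqrt.2 (by norm_num)) (by omega)
      _ = 2 ^ (A ∩ B).card := by rw [pow_mul, Real.sq_sqrt (by norm_num)]
  -- Origin of the constant 18: after squaring, this reads `8 / 9 ≤ exp (-1 / 9)`, an instance of `1
  -- + x ≤ exp x`.
  have h2 : (4 / 3 : ℝ) ≤ Real.sqrt 2 * Real.exp (-(1 / 18)) := by
    refine (sq_le_sq₀ (by norm_num) (by positivity)).1 ?_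
    rw [mul_pow, Real.sq_sqrt (by norm_num), ← Real.exp_nat_mul]
    have := Real.add_one_le_exp (((2 : ℕ) : ℝ) * -(1 / 18))
    norm_num at this ⊢
    linarith
  have h3 : (4 / 3 : ℝ) ^ c ≤ Real.sqrt 2 ^ c * Real.exp (-(c / 18 : ℝ)) := by
    calc (4 / 3 : ℝ) ^ c ≤ (Real.sqrt 2 * Real.exp (-(1 / 18))) ^ c := by gcongr
      _ = _ := by
        rw [mul_pow, ← Real.exp_nat_mul]; congr 2; ring
  have h4 : (0 : ℝ) < Real.sqrt 2 ^ c := by positivity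
  refine le_of_mul_le_mul_right (h1.trans ?_) h4
  calc (n.choose c : ℝ) * (4 / 3 : ℝ) ^ c
      ≤ n.choose c * (Real.sqrt 2 ^ c * Real.exp (-(c / 18 : ℝ))) := by gcongr
    _ = _ := by ring

theorem IsUniformCommittee.measurableSet {Ω : Type*} [MeasurableSpace Ω] {μ : Measure Ω} {n nc : ℕ}
    {X : Ω → Finset (Fin n)} (hX : IsUniformCommittee μ nc X) (p : Finset (Fin n) → Prop) :
    MeasurableSet {ω | p (X ω)} := by
  have : {ω | p (X ω)} = ⋃ A ∈ {A | p A}, {ω | X ω = A} := by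
    ext ω; simp
  rw [this]
  exact MeasurableSet.biUnion (Set.to_countable _) fun A _ => (hX A).1

/-- A Hoeffding bound for sampling without replacement. -/
theorem IsUniformCommittee.measure_majority_le {Ω : Type*} [MeasurableSpace Ω] {μ : Measure Ω}
    {n nc : ℕ} {X : Ω → Finset (Fin n)} (hX : IsUniformCommittee μ nc X) (B : Finset (Fin n))
    (hB : 3 * B.card ≤ n) :
    μ {ω | nc / 2 < (X ω ∩ B).card} ≤ ENNReal.ofReal (Real.exp (-(nc / 18 : ℝ))) := by
  classical
  set bad := Finset.univ.filter (fun A : Finset (Fin n) => nc / 2 < (A ∩ B).card) with hbad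
  have h0 : {ω | nc / 2 < (X ω ∩ B).card} = ⋃ A ∈ bad, {ω | X ω = A} := by
    ext ω; simp [hbad]
  have h1 : bad.filter (fun A => A.card = nc) =
      (Finset.powersetCard nc Finset.univ).filter (fun A => nc / 2 < (A ∩ B).card) := by
    ext A; simp [hbad, Finset.mem_powersetCard, and_comm]
  calc μ {ω | nc / 2 < (X ω ∩ B).card}
      ≤ ∑ A ∈ bad, μ {ω | X ω = A} := by rw [h0]; exact measure_biUnion_finset_le _ _
    _ = ∑ A ∈ bad, if A.card = nc then ((n.choose nc : ℕ) : ENNReal)⁻¹ else 0 :=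
        Finset.sum_congr rfl fun A _ => (hX A).2
    _ = ((((Finset.powersetCard nc Finset.univ).filter
          (fun A : Finset (Fin n) => nc / 2 < (A ∩ B).card)).card : ℕ) : ENNReal) /
            ((n.choose nc : ℕ) : ENNReal) := by
        rw [← Finset.sum_filter, h1, Finset.sum_const, nsmul_eq_mul, div_eq_mul_inv]
    _ ≤ _ := by
        -- This form needs no positivity of `n.choose nc`, so the case `nc > n` is covered.
        apply ENNReal.div_le_of_le_mul
        rw [← ENNReal.ofReal_natCast, ← ENNReal.ofReal_natCast (n.choose nc),
          ← ENNReal.ofReal_mul (Real.exp_pos _).le]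
        exact ENNReal.ofReal_le_ofReal (card_bad_committees_le nc B hB)

/-- With probability at least `1 - ε`, no committee of a sender has a Byzantine majority. -/
theorem measure_exists_majority_le {Ω : Type*} [MeasurableSpace Ω] {μ : Measure Ω}
    {n nc φ : ℕ} {ε : ℝ} (hε : 0 < ε) (hφ : 1 ≤ φ) (hnc : 18 * Real.log ((φ : ℝ) / ε) ≤ (nc : ℝ))
    {X : Ω → ℕ → Finset (Fin n)}
    (hX : ∀ ρ < φ, IsUniformCommittee μ nc (fun ω => X ω ρ)) (B : Finset (Fin n))
    (hB : 3 * B.card ≤ n) :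
    μ {ω | ∃ ρ < φ, nc / 2 < (X ω ρ ∩ B).card} ≤ ENNReal.ofReal ε := by
  have hφ' : (0 : ℝ) < φ := by exact_mod_cast hφ
  have h0 : {ω | ∃ ρ < φ, nc / 2 < (X ω ρ ∩ B).card} =
      ⋃ ρ ∈ Finset.range φ, {ω | nc / 2 < (X ω ρ ∩ B).card} := by
    ext ω; simp
  have h1 : Real.exp (-(nc / 18 : ℝ)) ≤ ε / φ := by
    calc Real.exp (-(nc / 18 : ℝ)) ≤ Real.exp (-Real.log ((φ : ℝ) / ε)) :=
          Real.exp_le_exp.2 (by linarith)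
      _ = ε / φ := by rw [Real.exp_neg, Real.exp_log (by positivity), inv_div]
  -- Union bound over the residues; the committees need not be independent.
  calc μ {ω | ∃ ρ < φ, nc / 2 < (X ω ρ ∩ B).card}
      ≤ ∑ ρ ∈ Finset.range φ, μ {ω | nc / 2 < (X ω ρ ∩ B).card} := by
        rw [h0]; exact measure_biUnion_finset_le _ _
    _ ≤ ∑ ρ ∈ Finset.range φ, ENNReal.ofReal (ε / φ) :=
        Finset.sum_le_sum fun ρ hρ =>
          ((hX ρ (Finset.mem_range.1 hρ)).measure_majority_le B hB).trans
            (ENNReal.ofReal_le_ofReal h1)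
    _ = ENNReal.ofReal ε := by
        rw [Finset.sum_const, Finset.card_range, nsmul_eq_mul, ← ENNReal.ofReal_natCast,
          ← ENNReal.ofReal_mul hφ'.le, mul_div_cancel₀ _ hφ'.ne']

/-! ### The execution -/

variable {n : ℕ} {P D : Type*}

/-- `L'` extends `L` in all components that only accumulate. -/
structure Grows (L L' : LocalState n P D) : Prop where
  rcvd : L.rcvd ⊆ L'.rcvd
  out : L.out ⊆ L'.out
  signed : L.signed ⊆ L'.signed
  certs : L.certs ⊆ L'.certs
  walks : L.walks ⊆ L'.walks
  walked : L.walked ⊆ L'.walked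
  delivered : L.delivered ⊆ L'.delivered
  promise : ∀ j y m, L.promise j y = some m → L'.promise j y = some m

theorem Grows.refl (L : LocalState n P D) : Grows L L :=
  ⟨subset_rfl, subset_rfl, subset_rfl, subset_rfl, subset_rfl, subset_rfl, subset_rfl,
    fun _ _ _ h => h⟩

theorem Grows.trans {L₁ L₂ L₃ : LocalState n P D} (h : Grows L₁ L₂) (h' : Grows L₂ L₃) :
    Grows L₁ L₃ :=
  ⟨h.rcvd.trans h'.rcvd, h.out.trans h'.out, h.signed.trans h'.signed, h.certs.trans h'.certs,
    h.walks.trans h'.walks, h.walked.trans h'.walked, h.delivered.trans h'.delivered,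
    fun j y m hm => h'.promise j y m (h.promise j y m hm)⟩

theorem Grows.send (L : LocalState n P D) (dsts : Finset (Fin n)) (x : Payload n P D) :
    Grows L (L.send dsts x) :=
  { Grows.refl L with out := Set.subset_union_left }

theorem Grows.startWalk (L : LocalState n P D) (w : Walk n D) : Grows L (L.startWalk w) :=
  { Grows.refl L with walks := Set.subset_insert _ _ }

theorem Grows.hasSent {L L' : LocalState n P D} (h : Grows L L') {dsts : Finset (Fin n)}
    {x : Payload n P D} (hs : L.hasSent dsts x) : L'.hasSent dsts x :=
  fun q hq => h.out (hs q hq)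

/-- `K` arises from `L` by processing certificates: only `certs`, `triggers` and `walks` differ. -/
structure SameCore (L K : LocalState n P D) : Prop where
  rcvd : K.rcvd = L.rcvd
  out : K.out = L.out
  own : K.own = L.own
  accepted : K.accepted = L.accepted
  signed : K.signed = L.signed
  promises : K.promises = L.promises
  reqDone : K.reqDone = L.reqDone
  collected : K.collected = L.collected
  walked : K.walked = L.walked
  delivered : K.delivered = L.delivered
  certs : L.certs ⊆ K.certs
  walks : L.walks ⊆ K.walks

theorem SameCore.refl (L : LocalState n P D) : SameCore L L :=
  ⟨rfl, rfl, rfl, rfl, rfl, rfl, rfl, rfl, rfl, rfl, subset_rfl, subset_rfl⟩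

theorem SameCore.trans {L₁ L₂ L₃ : LocalState n P D} (h : SameCore L₁ L₂) (h' : SameCore L₂ L₃) :
    SameCore L₁ L₃ :=
  ⟨h'.rcvd.trans h.rcvd, h'.out.trans h.out, h'.own.trans h.own, h'.accepted.trans h.accepted,
    h'.signed.trans h.signed, h'.promises.trans h.promises, h'.reqDone.trans h.reqDone,
    h'.collected.trans h.collected, h'.walked.trans h.walked, h'.delivered.trans h.delivered,
    h.certs.trans h'.certs, h.walks.trans h'.walks⟩

theorem SameCore.grows {L K : LocalState n P D} (h : SameCore L K) : Grows L K where
  rcvd := h.rcvd.symm.subset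
  out := h.out.symm.subset
  signed := h.signed.symm.subset
  certs := h.certs
  walks := h.walks
  walked := h.walked.symm.subset
  delivered := h.delivered.symm.subset
  promise j y m hm := by
    unfold LocalState.promise at hm ⊢
    rw [h.promises]; exact hm

theorem sameCore_processCertificate (S : Setup n P D) (c : Cert n D) (L : LocalState n P D) :
    SameCore L (S.processCertificate c L) := by
  unfold Setup.processCertificate
  dsimp only
  split_ifs
  · exact ⟨rfl, rfl, rfl, rfl, rfl, rfl, rfl, rfl, rfl, rfl, Set.subset_insert _ _,
      Set.subset_insert _ _⟩
  · exact ⟨rfl, rfl, rfl, rfl, rfl, rfl, rfl, rfl, rfl, rfl, Set.subset_insert _ _,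
      Set.subset_insert _ _⟩
  · exact ⟨rfl, rfl, rfl, rfl, rfl, rfl, rfl, rfl, rfl, rfl, Set.subset_insert _ _,
      subset_rfl⟩

theorem foldl_induction {α β : Type*} (p : β → Prop) (f : β → α → β)
    (hf : ∀ b a, p b → p (f b a)) (l : List α) (b : β) (hb : p b) : p (l.foldl f b) := by
  induction l generalizing b with
  | nil => exact hb
  | cons a l ih => exact ih _ (hf b a hb)

/-- A call of `deliver` does nothing if the round is already delivered, and otherwise adds the
message to the delivered ones before processing certificates. -/
theorem deliver_cases (S : Setup n P D) (m : Msg n P D) (L : LocalState n P D) :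
    ((∃ m' ∈ L.delivered, m'.sender = m.sender ∧ m'.round = m.round) ∧ S.deliver m L = L) ∨
      SameCore { L with delivered := insert m L.delivered } (S.deliver m L) := by
  unfold Setup.deliver
  split_ifs with h
  · exact Or.inl ⟨h, rfl⟩
  · refine Or.inr (foldl_induction (SameCore { L with delivered := insert m L.delivered }) _ ?_ _ _
      (SameCore.refl _))
    intro K j hK
    split
    · split_ifs
      · exact hK.trans (sameCore_processCertificate S _ K)
      · exact hK
    · exact hK

theorem grows_deliver (S : Setup n P D) (m : Msg n P D) (L : LocalState n P D) :
    Grows L (S.deliver m L) := by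
  rcases deliver_cases S m L with ⟨_, h⟩ | h
  · rw [h]; exact Grows.refl L
  · exact Grows.trans (L₂ := { L with delivered := insert m L.delivered })
      { Grows.refl L with delivered := Set.subset_insert _ _ } h.grows

theorem deliver_walked (S : Setup n P D) (m : Msg n P D) (L : LocalState n P D) :
    (S.deliver m L).walked = L.walked := by
  rcases deliver_cases S m L with ⟨_, h⟩ | h
  · rw [h]
  · exact h.walked

theorem deliver_delivered_subset (S : Setup n P D) (m : Msg n P D) (L : LocalState n P D) :
    (S.deliver m L).delivered ⊆ insert m L.delivered := by
  rcases deliver_cases S m L with ⟨_, h⟩ | h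
  · rw [h]; exact Set.subset_insert _ _
  · exact h.delivered.subset

/-- The witness may differ from `m` if the round was delivered before; this is why the conclusion on
sequentiality speaks of some message of the previous round. -/
theorem exists_mem_deliver_delivered (S : Setup n P D) (m : Msg n P D) (L : LocalState n P D) :
    ∃ m' ∈ (S.deliver m L).delivered, m'.sender = m.sender ∧ m'.round = m.round := by
  rcases deliver_cases S m L with ⟨h', h⟩ | h
  · rw [h]; exact h'
  · exact ⟨m, h.delivered.symm.subset (Set.mem_insert _ _), rfl, rfl⟩

/-- The state after a step of a backward walk, before walking on. -/
noncomputable def Setup.walkArrive (S : Setup n P D) (w : Walk n D) (m : Msg n P D)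
    (L : LocalState n P D) : LocalState n P D :=
  let L₁ : LocalState n P D := if w.cert.round ≤ w.top then S.deliver m L else L
  { L₁ with walked := insert w L₁.walked }

theorem grows_walkArrive (S : Setup n P D) (w : Walk n D) (m : Msg n P D) (L : LocalState n P D) :
    Grows L (S.walkArrive w m L) := by
  unfold Setup.walkArrive
  dsimp only
  split_ifs
  · exact (grows_deliver S m L).trans
      { Grows.refl (S.deliver m L) with walked := Set.subset_insert _ _ }
  · exact { Grows.refl L with walked := Set.subset_insert _ _ }

/-- Separates arrival at a position from moving on. When the walk stops, the failure of the guard is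
recorded: it is what rules out stopping at a well-formed parent. -/
theorem effect_walkStep (S : Setup n P D) (N : Fin n → ℕ → Finset (Fin n)) (k : Fin n)
    (L : LocalState n P D) (w : Walk n D) (src : Fin n) (m : Msg n P D) :
    (S.effect N k L (.walkStep w src m) = S.walkArrive w m L ∧
      ∀ c, m.parent = some c →
        ¬ (c.sender = w.cert.sender ∧ 1 ≤ c.round ∧ c.round + 1 = w.cert.round)) ∨
    ∃ c, m.parent = some c ∧
      S.effect N k L (.walkStep w src m) = (S.walkArrive w m L).startWalk ⟨c, w.top⟩ := by
  simp only [Setup.effect]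
  rw [← Setup.walkArrive]
  split
  · rename_i c hc
    split_ifs with h
    · exact Or.inr ⟨c, hc, rfl⟩
    · refine Or.inl ⟨rfl, fun c' hc' => ?_⟩
      rw [hc] at hc'
      cases hc'
      exact h
  · rename_i hc
    refine Or.inl ⟨rfl, fun c' hc' => ?_⟩
    rw [hc] at hc'
    cases hc'

/-- Holds without the guard of the action, because `Grows` omits `own`, `accepted` and `triggers`,
whose entries an update overwrites. Promises are only appended to, so earlier entries keep their
index. -/
theorem grows_effect (S : Setup n P D) (N : Fin n → ℕ → Finset (Fin n)) (k : Fin n)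
    (L : LocalState n P D) (a : Action n P D) : Grows L (S.effect N k L a) := by
  cases a with
  | startReq r => exact { Grows.refl L with }
  | finishReq j y => exact { Grows.refl L with }
  | broadcast r =>
    exact Grows.trans (L₂ := { L with own := Function.update L.own r (some (S.newMsg k r L)) })
      { Grows.refl L with } (Grows.send _ _ _)
  | accept src m => exact { Grows.refl L with }
  | sign m =>
    exact Grows.trans (L₂ := { L with signed := insert m L.signed })
      { Grows.refl L with signed := Set.subset_insert _ _ }
      ((Grows.send _ _ _).trans (Grows.send _ _ _))
  | fetchRequest i r b => exact Grows.send _ _ _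
  | fetchCert i r => exact Grows.send _ _ _
  | fetchStore i r b src m =>
    refine { Grows.refl L with promise := fun j y p hp => ?_ }
    unfold LocalState.promise at hp ⊢
    dsimp only [Setup.effect]
    rcases eq_or_ne j i with rfl | hj
    · rw [Function.update_self]
      have := List.getElem?_eq_some_iff.1 hp
      rw [List.getElem?_append_left this.1]
      exact hp
    · rw [Function.update_of_ne hj]
      exact hp
  | reply dst b m => exact Grows.send _ _ _
  | replyCert dst m => exact Grows.send _ _ _
  | obtainCert c => exact (sameCore_processCertificate S c L).grows
  | walkRequest w => exact Grows.send _ _ _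
  | walkStep w src m =>
    rcases effect_walkStep S N k L w src m with ⟨h, _⟩ | ⟨c, _, h⟩
    · rw [h]; exact grows_walkArrive S w m L
    · rw [h]; exact (grows_walkArrive S w m L).trans (Grows.startWalk _ _)
  | collectRequest j r => exact Grows.send _ _ _
  | collect src m => exact { Grows.refl L with }
  | deliverAll c => exact Grows.startWalk _ _
  | deliverQuorum c Q => exact Grows.startWalk _ _

theorem Setup.Step.grows {S : Setup n P D} {N : Fin n → ℕ → Finset (Fin n)}
    {s s' : Fin n → LocalState n P D} {e : Event n P D} (h : S.Step N s s' e) (k : Fin n) :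
    Grows (s k) (s' k) := by
  cases e with
  | act j a =>
    obtain ⟨-, -, rfl⟩ := h
    rcases eq_or_ne k j with rfl | hj
    · rw [Function.update_self]; exact grows_effect S N k _ a
    · rw [Function.update_of_ne hj]; exact Grows.refl _
  | receive src dst x =>
    obtain ⟨-, rfl⟩ := h
    rcases eq_or_ne k dst with rfl | hj
    · rw [Function.update_self]
      exact { Grows.refl (s k) with rcvd := Set.subset_insert _ _ }
    · rw [Function.update_of_ne hj]; exact Grows.refl _
  | corrupt b dst x =>
    obtain ⟨-, -, rfl⟩ := h
    rcases eq_or_ne k b with rfl | hj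
    · rw [Function.update_self]
      exact { Grows.refl (s k) with out := Set.subset_insert _ _ }
    · rw [Function.update_of_ne hj]; exact Grows.refl _
  | idle =>
    cases h
    exact Grows.refl _

theorem Setup.IsExecution.grows {S : Setup n P D} {N : Fin n → ℕ → Finset (Fin n)}
    {E : Execution n P D} (h : S.IsExecution N E) {t t' : ℕ} (ht : t ≤ t') (k : Fin n) :
    Grows (E.state t k) (E.state t' k) := by
  induction t', ht using Nat.le_induction with
  | base => exact Grows.refl _
  | succ t' _ ih => exact ih.trans ((h.step t').grows k)

/-! ### No certificate is forged -/

/-- Genuineness depends on the global state only through the sets `signed`, which grow; once true,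
it stays true. -/
theorem Setup.ShareIssued.mono {S : Setup n P D} {s s' : Fin n → LocalState n P D}
    (hs : ∀ k, (s k).signed ⊆ (s' k).signed) {j : Fin n} {c : Cert n D}
    (h : S.ShareIssued s j c) : S.ShareIssued s' j c :=
  h.imp id fun ⟨m, hm, e⟩ => ⟨m, hs j hm, e⟩

theorem Setup.CertFormable.mono {S : Setup n P D} {N : Fin n → ℕ → Finset (Fin n)}
    {s s' : Fin n → LocalState n P D} (hs : ∀ k, (s k).signed ⊆ (s' k).signed) {c : Cert n D}
    (h : S.CertFormable N s c) : S.CertFormable N s' c := by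
  classical
  refine le_trans h (Finset.card_le_card ?_)
  intro q hq
  rw [Finset.mem_filter] at hq ⊢
  exact ⟨hq.1, hq.2.mono hs⟩

/-- All certificates contained in `m` are genuine. -/
structure MsgGenuine (S : Setup n P D) (N : Fin n → ℕ → Finset (Fin n))
    (s : Fin n → LocalState n P D) (m : Msg n P D) : Prop where
  parent : ∀ c, m.parent = some c → S.CertFormable N s c
  prev : ∀ j c, m.prev j = some c → S.CertFormable N s c
  triggers : ∀ j c, m.triggers j = some c → S.CertFormable N s c

/-- All shares and certificates contained in a payload are genuine. -/
def PayloadGenuine (S : Setup n P D) (N : Fin n → ℕ → Finset (Fin n))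
    (s : Fin n → LocalState n P D) : Payload n P D → Prop
  | .msg m => MsgGenuine S N s m
  | .share j c => S.ShareIssued s j c
  | .cert c => S.CertFormable N s c
  | .request _ _ _ => True
  | .response m => MsgGenuine S N s m

theorem MsgGenuine.mono {S : Setup n P D} {N : Fin n → ℕ → Finset (Fin n)}
    {s s' : Fin n → LocalState n P D} (hs : ∀ k, (s k).signed ⊆ (s' k).signed) {m : Msg n P D}
    (h : MsgGenuine S N s m) : MsgGenuine S N s' m :=
  ⟨fun c hc => (h.parent c hc).mono hs, fun j c hc => (h.prev j c hc).mono hs,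
    fun j c hc => (h.triggers j c hc).mono hs⟩

theorem PayloadGenuine.mono {S : Setup n P D} {N : Fin n → ℕ → Finset (Fin n)}
    {s s' : Fin n → LocalState n P D} (hs : ∀ k, (s k).signed ⊆ (s' k).signed) {x : Payload n P D}
    (h : PayloadGenuine S N s x) : PayloadGenuine S N s' x := by
  cases x with
  | msg m => exact MsgGenuine.mono hs h
  | share j c => exact Setup.ShareIssued.mono hs h
  | cert c => exact Setup.CertFormable.mono hs h
  | request _ _ _ => trivial
  | response m => exact MsgGenuine.mono hs h

theorem payloadGenuine_of_adversarySendable {S : Setup n P D} {N : Fin n → ℕ → Finset (Fin n)}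
    {s : Fin n → LocalState n P D} {x : Payload n P D} (h : S.AdversarySendable N s x) :
    PayloadGenuine S N s x := by
  cases x with
  | msg m => exact ⟨h.2.1, h.2.2.1, h.2.2.2⟩
  | share j c => exact h
  | cert c => exact h
  | request _ _ _ => trivial
  | response m => exact ⟨h.2.1, h.2.2.1, h.2.2.2⟩

/-- Everything in the local state `L` is genuine in the global state `s`, and the promises are
chains of messages. -/
structure LocalGenuine (S : Setup n P D) (N : Fin n → ℕ → Finset (Fin n))
    (s : Fin n → LocalState n P D) (L : LocalState n P D) : Prop where
  rcvd : ∀ q ∈ L.rcvd, PayloadGenuine S N s q.2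
  out : ∀ q ∈ L.out, PayloadGenuine S N s q.2
  own : ∀ r m, L.own r = some m → MsgGenuine S N s m
  accepted : ∀ j r m, L.accepted j r = some m → MsgGenuine S N s m
  signed : ∀ m ∈ L.signed, MsgGenuine S N s m
  promises : ∀ j, ∀ m ∈ L.promises j, MsgGenuine S N s m
  certs : ∀ c ∈ L.certs, S.CertFormable N s c
  triggers : ∀ j c, L.triggers j = some c → S.CertFormable N s c
  collected : ∀ m ∈ L.collected, MsgGenuine S N s m
  walks : ∀ w ∈ L.walks, S.CertFormable N s w.cert
  delivered : ∀ m ∈ L.delivered, MsgGenuine S N s m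
  promises_spec : ∀ j y m, (L.promises j)[y]? = some m → m.sender = j ∧ m.round = y + 1
  signed_spec : ∀ m ∈ L.signed, 1 < m.round →
    ∃ p : Msg n P D, p.sender = m.sender ∧ p.round + 1 = m.round ∧ m.parent = some (S.certOf p)
  reqDone_spec : ∀ j y, j ∈ L.reqDone y → ∃ m, L.promise j y = some m ∧ S.certOf m ∈ L.certs

variable {S : Setup n P D} {N : Fin n → ℕ → Finset (Fin n)} {s s' : Fin n → LocalState n P D}
  {L : LocalState n P D}

theorem localGenuine_empty : LocalGenuine S N s (LocalState.empty n P D) := by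
  constructor <;> simp [LocalState.empty]

/-- With the global state and the local state as separate parameters, a transition can be treated in
two moves: first pass to the new global state, then change the local one. -/
theorem LocalGenuine.mono (hs : ∀ k, (s k).signed ⊆ (s' k).signed) (h : LocalGenuine S N s L) :
    LocalGenuine S N s' L where
  rcvd q hq := (h.rcvd q hq).mono hs
  out q hq := (h.out q hq).mono hs
  own r m hm := (h.own r m hm).mono hs
  accepted j r m hm := (h.accepted j r m hm).mono hs
  signed m hm := (h.signed m hm).mono hs
  promises j m hm := (h.promises j m hm).mono hs
  certs c hc := (h.certs c hc).mono hs
  triggers j c hc := (h.triggers j c hc).mono hs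
  collected m hm := (h.collected m hm).mono hs
  walks w hw := (h.walks w hw).mono hs
  delivered m hm := (h.delivered m hm).mono hs
  promises_spec := h.promises_spec
  signed_spec := h.signed_spec
  reqDone_spec := h.reqDone_spec

theorem LocalGenuine.send (h : LocalGenuine S N s L) (dsts : Finset (Fin n)) {x : Payload n P D}
    (hx : PayloadGenuine S N s x) : LocalGenuine S N s (L.send dsts x) :=
  { h with
    out := by
      rintro q (hq | ⟨-, rfl⟩)
      · exact h.out q hq
      · exact hx
    reqDone_spec := h.reqDone_spec }

theorem LocalGenuine.startWalk (h : LocalGenuine S N s L) {w : Walk n D}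
    (hw : S.CertFormable N s w.cert) : LocalGenuine S N s (L.startWalk w) :=
  { h with
    walks := by
      rintro v (rfl | hv)
      · exact hw
      · exact h.walks v hv
    reqDone_spec := h.reqDone_spec }

/-- The round is `y - 1 + 1` and not `y`, since `promise j 0` reads the same list entry as `promise
j 1`. -/
theorem LocalGenuine.promise (h : LocalGenuine S N s L) {j : Fin n} {y : ℕ} {m : Msg n P D}
    (hm : L.promise j y = some m) : MsgGenuine S N s m ∧ m.sender = j ∧ m.round = y - 1 + 1 :=
  ⟨h.promises j m (List.mem_of_getElem? hm), h.promises_spec j _ m hm⟩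

theorem LocalGenuine.processCertificate (h : LocalGenuine S N s L) {c : Cert n D}
    (hc : S.CertFormable N s c) : LocalGenuine S N s (S.processCertificate c L) := by
  have h1 : LocalGenuine S N s { L with certs := insert c L.certs } :=
    { h with
      certs := by
        rintro d (rfl | hd)
        · exact hc
        · exact h.certs d hd
      reqDone_spec := fun j y hj =>
        let ⟨m, hm, hm'⟩ := h.reqDone_spec j y hj
        ⟨m, hm, Or.inr hm'⟩ }
  unfold Setup.processCertificate
  dsimp only
  split_ifs
  · refine LocalGenuine.startWalk ?_ hc
    exact { h1 with
      triggers := by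
        intro j d hd
        dsimp only at hd
        rcases eq_or_ne j c.sender with rfl | hj
        · rw [Function.update_self] at hd
          cases hd
          exact hc
        · rw [Function.update_of_ne hj] at hd
          exact h.triggers j d hd
      reqDone_spec := h1.reqDone_spec }
  · exact LocalGenuine.startWalk h1 hc
  · exact h1

theorem LocalGenuine.deliver (h : LocalGenuine S N s L) {m : Msg n P D}
    (hm : MsgGenuine S N s m) : LocalGenuine S N s (S.deliver m L) := by
  unfold Setup.deliver
  split_ifs
  · exact h
  · refine foldl_induction (LocalGenuine S N s) _ ?_ _ _ ?_
    · intro K j hK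
      split
      · rename_i c hc
        split_ifs
        · exact hK.processCertificate (hm.triggers j c hc)
        · exact hK
      · exact hK
    · exact { h with
        delivered := by
          rintro d (rfl | hd)
          · exact hm
          · exact h.delivered d hd
        reqDone_spec := h.reqDone_spec }

theorem LocalGenuine.walkArrive (h : LocalGenuine S N s L) (w : Walk n D) {m : Msg n P D}
    (hm : MsgGenuine S N s m) : LocalGenuine S N s (S.walkArrive w m L) := by
  unfold Setup.walkArrive
  dsimp only
  split_ifs
  · exact { h.deliver hm with reqDone_spec := (h.deliver hm).reqDone_spec }
  · exact { h with reqDone_spec := h.reqDone_spec }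

/-- Everything an honest sender includes has a certificate it holds: its own predecessor by the
broadcast guard, the `prev` entries by `reqDone_spec`. -/
theorem LocalGenuine.newMsg (h : LocalGenuine S N s L) {k : Fin n} {r : ℕ}
    (hr : r ≠ 1 → ∃ m, L.own (r - 1) = some m ∧ S.certOf m ∈ L.certs) :
    MsgGenuine S N s (S.newMsg k r L) where
  parent c hc := by
    dsimp only [Setup.newMsg] at hc
    split_ifs at hc with h1
    obtain ⟨m, hm, hm'⟩ := hr h1
    rw [hm] at hc
    cases hc
    exact h.certs _ hm'
  prev j c hc := by
    dsimp only [Setup.newMsg] at hc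
    split_ifs at hc with h1
    obtain ⟨m, hm, hm'⟩ := h.reqDone_spec j _ (List.mem_of_mem_take h1.2)
    rw [hm] at hc
    cases hc
    exact h.certs _ hm'
  triggers j c hc := h.triggers j c hc

/-- Here `s` is meant to be the global state after the action. Then `hs` is available, and the share
sent while signing counts as issued. -/
theorem LocalGenuine.effect (h : LocalGenuine S N s L) {k : Fin n} {a : Action n P D}
    (ha : S.Enabled N k L a)
    (hs : ∀ m ∈ (S.effect N k L a).signed, S.ShareIssued s k (S.certOf m)) :
    LocalGenuine S N s (S.effect N k L a) := by
  cases a with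
  | startReq r => exact { h with reqDone_spec := h.reqDone_spec }
  | finishReq j y =>
    refine { h with reqDone_spec := fun j' y' hj' => ?_ }
    dsimp only [Setup.effect] at hj'
    rcases eq_or_ne y' y with rfl | hy
    · rw [Function.update_self, List.mem_append, List.mem_singleton] at hj'
      rcases hj' with hj' | rfl
      · exact h.reqDone_spec j' y' hj'
      · exact ha.2.2
    · rw [Function.update_of_ne hy] at hj'
      exact h.reqDone_spec j' y' hj'
  | broadcast r =>
    have hm : MsgGenuine S N s (S.newMsg k r L) := by
      refine h.newMsg fun hr => ?_
      rcases ha.2 with h1 | h1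
      · exact absurd h1 hr
      · exact h1.2.1
    refine LocalGenuine.send (x := .msg (S.newMsg k r L)) ?_ _ hm
    refine { h with own := fun r' m' hm' => ?_, reqDone_spec := h.reqDone_spec }
    dsimp only at hm'
    rcases eq_or_ne r' r with rfl | hr
    · rw [Function.update_self] at hm'
      cases hm'
      exact hm
    · rw [Function.update_of_ne hr] at hm'
      exact h.own r' m' hm'
  | accept src m =>
    refine { h with accepted := fun j r m' hm' => ?_, reqDone_spec := h.reqDone_spec }
    dsimp only [Setup.effect] at hm'
    rcases eq_or_ne j m.sender with rfl | hj
    · rw [Function.update_self] at hm'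
      rcases eq_or_ne r m.round with rfl | hr
      · rw [Function.update_self] at hm'
        cases hm'
        exact h.rcvd _ ha.1
      · rw [Function.update_of_ne hr] at hm'
        exact h.accepted _ _ _ hm'
    · rw [Function.update_of_ne hj] at hm'
      exact h.accepted _ _ _ hm'
  | sign m =>
    have hm : MsgGenuine S N s m := h.accepted _ _ _ ha.1
    have hk : S.ShareIssued s k (S.certOf m) := hs m (Set.mem_insert _ _)
    refine LocalGenuine.send (x := .share k (S.certOf m))
      (LocalGenuine.send (x := .msg m) ?_ _ hm) _ hk
    refine { h with signed := ?_, signed_spec := ?_, reqDone_spec := h.reqDone_spec }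
    · rintro m' (rfl | hm')
      · exact hm
      · exact h.signed m' hm'
    · rintro m' (rfl | hm') hr
      -- The honest signer's check that the message extends its promises is what yields the
      -- predecessor in `signed_spec`.
      · rcases ha.2.2 with h1 | ⟨p, hp, hp'⟩
        · omega
        · have := h.promise hp
          exact ⟨p, this.2.1, by omega, hp'⟩
      · exact h.signed_spec m' hm' hr
  | fetchRequest i r b => exact h.send _ trivial
  | fetchCert i r => exact h.send _ trivial
  | fetchStore i r b src m =>
    obtain ⟨-, -, hi, hr, -, hm, -⟩ := ha
    have hg := grows_effect S N k L (.fetchStore i r b src m)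
    refine { h with
      promises := fun j m' hm' => ?_
      promises_spec := fun j y m' hm' => ?_
      reqDone_spec := fun j y hj =>
        let ⟨m', h1, h2⟩ := h.reqDone_spec j y hj
        ⟨m', hg.promise j y m' h1, h2⟩ }
    · dsimp only [Setup.effect] at hm'
      rcases eq_or_ne j i with rfl | hj
      · rw [Function.update_self, List.mem_append, List.mem_singleton] at hm'
        rcases hm' with hm' | rfl
        · exact h.promises _ _ hm'
        · exact h.rcvd _ hm
      · rw [Function.update_of_ne hj] at hm'
        exact h.promises _ _ hm'
    · dsimp only [Setup.effect] at hm'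
      rcases eq_or_ne j i with rfl | hj
      · rw [Function.update_self, List.getElem?_append] at hm'
        split_ifs at hm' with hy
        · exact h.promises_spec _ _ _ hm'
        · rw [List.getElem?_singleton] at hm'
          split_ifs at hm' with hy'
          cases hm'
          exact ⟨hi, by omega⟩
      · rw [Function.update_of_ne hj] at hm'
        exact h.promises_spec _ _ _ hm'
  | reply dst b m =>
    refine LocalGenuine.send (x := .response m) h _ ?_
    rcases ha.2.1 with h1 | h1 | h1
    · exact h.signed _ h1
    · exact h.promises _ _ h1
    · exact h.own _ _ h1
  | replyCert dst m => exact LocalGenuine.send (x := .cert (S.certOf m)) h _ (h.certs _ ha.2.2.1)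
  | obtainCert c =>
    refine h.processCertificate ?_
    rcases ha.2 with h1 | h1
    · classical
      -- Received shares are genuine, so the signers counted by the node are among those who can
      -- contribute a share.
      refine le_trans h1 (Finset.card_le_card ?_)
      intro q hq
      rw [Finset.mem_filter] at hq ⊢
      obtain ⟨hq1, src, hq2⟩ := hq
      exact ⟨hq1, h.rcvd _ hq2⟩
    · exact h.rcvd _ h1
  | walkRequest w => exact h.send _ trivial
  | walkStep w src m =>
    have hm : MsgGenuine S N s m := h.rcvd _ ha.2.2.2.2.1
    rcases effect_walkStep S N k L w src m with ⟨e, _⟩ | ⟨c, hc, e⟩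
    · rw [e]; exact h.walkArrive w hm
    · rw [e]; exact (h.walkArrive w hm).startWalk (hm.parent c hc)
  | collectRequest j r => exact h.send _ trivial
  | collect src m =>
    refine { h with collected := ?_, reqDone_spec := h.reqDone_spec }
    rintro m' (rfl | hm')
    · exact h.rcvd _ ha.2.2.1
    · exact h.collected _ hm'
  | deliverAll c =>
    obtain ⟨m, hm, -, -, hc⟩ := ha.2.1 c.sender
    exact h.startWalk ((h.collected m hm).prev _ _ hc)
  | deliverQuorum c Q =>
    obtain ⟨-, hQ, hQ', -⟩ := ha
    obtain ⟨j, hj⟩ : Q.Nonempty := by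
      rw [← Finset.card_pos]; omega
    obtain ⟨m, hm, -, -, hc⟩ := hQ' j hj
    exact h.startWalk ((h.delivered m hm).prev _ _ hc)

theorem Setup.Step.localGenuine {e : Event n P D} (h : S.Step N s s' e)
    (hs : ∀ k, LocalGenuine S N s (s k)) (k : Fin n) : LocalGenuine S N s' (s' k) := by
  have hm : ∀ k, (s k).signed ⊆ (s' k).signed := fun k => (h.grows k).signed
  have hs' : ∀ k, LocalGenuine S N s' (s k) := fun k => (hs k).mono hm
  cases e with
  | act j a =>
    obtain ⟨-, ha, e⟩ := h
    rcases eq_or_ne k j with rfl | hj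
    · have ek : s' k = S.effect N k (s k) a := by rw [e, Function.update_self]
      rw [ek]
      refine (hs' k).effect ha fun m hm => Or.inr ⟨m, ?_, rfl⟩
      rw [ek]
      exact hm
    · have ek : s' k = s k := by rw [e, Function.update_of_ne hj]
      rw [ek]
      exact hs' k
  | receive src dst x =>
    obtain ⟨hx, e⟩ := h
    rcases eq_or_ne k dst with rfl | hj
    · have ek : s' k = { s k with rcvd := insert (src, x) (s k).rcvd } := by
        rw [e, Function.update_self]
      rw [ek]
      refine { hs' k with rcvd := ?_, reqDone_spec := (hs' k).reqDone_spec }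
      rintro q (rfl | hq)
      · exact (hs' src).out (k, x) hx
      · exact (hs' k).rcvd q hq
    · have ek : s' k = s k := by rw [e, Function.update_of_ne hj]
      rw [ek]
      exact hs' k
  | corrupt b dst x =>
    obtain ⟨-, hx, e⟩ := h
    rcases eq_or_ne k b with rfl | hj
    · have ek : s' k = { s k with out := insert (dst, x) (s k).out } := by
        rw [e, Function.update_self]
      rw [ek]
      refine { hs' k with out := ?_, reqDone_spec := (hs' k).reqDone_spec }
      rintro q (rfl | hq)
      · exact (payloadGenuine_of_adversarySendable hx).mono hm
      · exact (hs' k).out q hq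
    · have ek : s' k = s k := by rw [e, Function.update_of_ne hj]
      rw [ek]
      exact hs' k
  | idle =>
    cases h
    exact hs k

/-- The induction runs over all nodes at once, Byzantine ones included: a received packet is genuine
because it was in the `out` of its source. -/
theorem Setup.IsExecution.localGenuine {E : Execution n P D} (h : S.IsExecution N E) (t : ℕ)
    (k : Fin n) : LocalGenuine S N (E.state t) (E.state t k) := by
  induction t generalizing k with
  | zero => rw [h.start]; exact localGenuine_empty
  | succ t ih => exact (h.step t).localGenuine ih k

/-! ### Backward walks -/

/-- A delivered message was found by a walk that continues with the certificate in it, and a walk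
leaves a position only after requesting, receiving and, if due, delivering the message. -/
structure WalkSound (S : Setup n P D) (N : Fin n → ℕ → Finset (Fin n)) (L : LocalState n P D) :
    Prop where
  delivered : ∀ m ∈ L.delivered, ∃ w ∈ L.walks, w.cert = S.certOf m ∧ m.round ≤ w.top ∧
    ∀ c, m.parent = some c → c.sender = m.sender → 1 ≤ c.round → c.round + 1 = m.round →
      (⟨c, w.top⟩ : Walk n D) ∈ L.walks
  walked : ∀ w ∈ L.walked,
    L.hasSent (S.committee N w.cert.sender w.cert.round)
      (.request w.cert.sender w.cert.round false) ∧
    (∃ src ∈ S.committee N w.cert.sender w.cert.round, ∃ m,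
      (src, .response m) ∈ L.rcvd ∧ S.certOf m = w.cert) ∧
    (w.cert.round ≤ w.top →
      ∃ m ∈ L.delivered, m.sender = w.cert.sender ∧ m.round = w.cert.round)

theorem walkSound_empty : WalkSound S N (LocalState.empty n P D) := by
  constructor <;> simp [LocalState.empty]

/-- New obligations arise only from new elements of `delivered` or `walked`; growth of the other
components preserves the existing witnesses. -/
theorem WalkSound.of_grows {L' : LocalState n P D} (h : WalkSound S N L) (hg : Grows L L')
    (hd : L'.delivered = L.delivered) (hw : L'.walked = L.walked) : WalkSound S N L' where
  delivered m hm := by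
    obtain ⟨w, h1, h2, h3, h4⟩ := h.delivered m (hd ▸ hm)
    exact ⟨w, hg.walks h1, h2, h3, fun c a1 a2 a3 a4 => hg.walks (h4 c a1 a2 a3 a4)⟩
  walked w hw' := by
    obtain ⟨h1, ⟨src, h2, m, h3, h4⟩, h5⟩ := h.walked w (hw ▸ hw')
    refine ⟨hg.hasSent h1, ⟨src, h2, m, hg.rcvd h3, h4⟩, ?_⟩
    rw [hd]
    exact h5

theorem walkArrive_walked (w : Walk n D) (m : Msg n P D) (L : LocalState n P D) :
    (S.walkArrive w m L).walked = insert w L.walked := by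
  unfold Setup.walkArrive
  dsimp only
  split_ifs
  · rw [deliver_walked]
  · rfl

theorem mem_walkArrive_delivered {w : Walk n D} {m m' : Msg n P D}
    (h : m' ∈ (S.walkArrive w m L).delivered) :
    (m' = m ∧ w.cert.round ≤ w.top) ∨ m' ∈ L.delivered := by
  unfold Setup.walkArrive at h
  dsimp only at h
  split_ifs at h with hw
  · rcases deliver_delivered_subset S m L h with h | h
    · exact Or.inl ⟨h, hw⟩
    · exact Or.inr h
  · exact Or.inr h

theorem exists_mem_walkArrive_delivered {w : Walk n D} {m : Msg n P D}
    (hw : w.cert.round ≤ w.top) :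
    ∃ m' ∈ (S.walkArrive w m L).delivered, m'.sender = m.sender ∧ m'.round = m.round := by
  unfold Setup.walkArrive
  dsimp only
  rw [if_pos hw]
  exact exists_mem_deliver_delivered S m L

theorem effect_walkStep_walked (k : Fin n) (w : Walk n D) (src : Fin n) (m : Msg n P D) :
    (S.effect N k L (.walkStep w src m)).walked = insert w L.walked := by
  rcases effect_walkStep S N k L w src m with ⟨e, _⟩ | ⟨c, _, e⟩
  · rw [e, walkArrive_walked]
  · rw [e]; exact walkArrive_walked w m L

theorem effect_walkStep_delivered (k : Fin n) (w : Walk n D) (src : Fin n) (m : Msg n P D) :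
    (S.effect N k L (.walkStep w src m)).delivered = (S.walkArrive w m L).delivered := by
  rcases effect_walkStep S N k L w src m with ⟨e, _⟩ | ⟨c, _, e⟩
  · rw [e]
  · rw [e]; rfl

theorem WalkSound.walkStep (h : WalkSound S N L) {k : Fin n} {w : Walk n D} {src : Fin n}
    {m : Msg n P D} (ha : S.Enabled N k L (.walkStep w src m)) :
    WalkSound S N (S.effect N k L (.walkStep w src m)) := by
  have hg := grows_effect S N k L (.walkStep w src m)
  obtain ⟨hw, -, hsent, hsrc, hrcvd, hcert⟩ := ha
  have hsender : w.cert.sender = m.sender := by rw [← hcert]; rfl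
  have hround : w.cert.round = m.round := by rw [← hcert]; rfl
  refine ⟨fun m' hm' => ?_, fun w' hw' => ?_⟩
  · rw [effect_walkStep_delivered] at hm'
    rcases mem_walkArrive_delivered hm' with ⟨rfl, htop⟩ | hm'
    -- The newly delivered message is witnessed by the current position. The conditions on `c` are
    -- exactly the guard of the walk, so it cannot have stopped here.
    · refine ⟨w, hg.walks hw, hcert.symm, by omega, fun c h1 h2 h3 h4 => ?_⟩
      rcases effect_walkStep S N k L w src m' with ⟨_, hno⟩ | ⟨c', hc', e⟩
      · exact absurd ⟨by rw [h2, hsender], h3, by omega⟩ (hno c h1)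
      · rw [h1] at hc'
        cases hc'
        rw [e]
        exact Set.mem_insert _ _
    · obtain ⟨v, h1, h2, h3, h4⟩ := h.delivered m' hm'
      exact ⟨v, hg.walks h1, h2, h3, fun c a1 a2 a3 a4 => hg.walks (h4 c a1 a2 a3 a4)⟩
  · rw [effect_walkStep_walked] at hw'
    rcases hw' with rfl | hw'
    · refine ⟨hg.hasSent hsent, ⟨src, hsrc, m, hg.rcvd hrcvd, hcert⟩, fun htop => ?_⟩
      rw [effect_walkStep_delivered, hsender, hround]
      exact exists_mem_walkArrive_delivered htop
    · obtain ⟨h1, ⟨src, h2, m, h3, h4⟩, h5⟩ := h.walked w' hw'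
      refine ⟨hg.hasSent h1, ⟨src, h2, m, hg.rcvd h3, h4⟩, fun htop => ?_⟩
      obtain ⟨m', hm', e⟩ := h5 htop
      exact ⟨m', hg.delivered hm', e⟩

theorem WalkSound.effect (h : WalkSound S N L) {k : Fin n} {a : Action n P D}
    (ha : S.Enabled N k L a) : WalkSound S N (S.effect N k L a) := by
  have hg := grows_effect S N k L a
  cases a with
  | walkStep w src m => exact h.walkStep ha
  | obtainCert c =>
    exact h.of_grows hg (sameCore_processCertificate S c L).delivered
      (sameCore_processCertificate S c L).walked
  | _ => exact h.of_grows hg rfl rfl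

theorem Setup.IsExecution.walkSound {E : Execution n P D} (h : S.IsExecution N E) (t : ℕ)
    (k : Fin n) : WalkSound S N (E.state t k) := by
  induction t with
  | zero => rw [h.start]; exact walkSound_empty
  | succ t ih =>
    have hstep := h.step t
    have hg := hstep.grows k
    generalize E.event t = e at hstep
    cases e with
    | act j a =>
      obtain ⟨-, ha, e⟩ := hstep
      rcases eq_or_ne k j with rfl | hj
      · rw [e, Function.update_self]; exact ih.effect ha
      · rw [e, Function.update_of_ne hj]; exact ih
    | receive src dst x =>
      obtain ⟨-, e⟩ := hstep
      refine ih.of_grows hg ?_ ?_ <;>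
      · rw [e]
        rcases eq_or_ne k dst with rfl | hj
        · rw [Function.update_self]
        · rw [Function.update_of_ne hj]
    | corrupt b dst x =>
      obtain ⟨-, -, e⟩ := hstep
      refine ih.of_grows hg ?_ ?_ <;>
      · rw [e]
        rcases eq_or_ne k b with rfl | hj
        · rw [Function.update_self]
        · rw [Function.update_of_ne hj]
    | idle => rw [show E.state (t + 1) = E.state t from hstep]; exact ih

/-! ### Progress -/

variable {E : Execution n P D}

/-- If `a` stays possible as long as `Q` fails, and taking it brings `Q` about, then `Q` happens. -/
theorem Setup.IsExecution.eventually_of_enabled (h : S.IsExecution N E) {k : Fin n}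
    (hk : k ∉ S.byz) {a : Action n P D} {t : ℕ} (Q : LocalState n P D → Prop)
    (hen : ∀ t' ≥ t, ¬ Q (E.state t' k) → S.Enabled N k (E.state t' k) a)
    (heff : ∀ L, Q (S.effect N k L a)) : ∃ t' ≥ t, Q (E.state t' k) := by
  -- If `Q` never held, the action would stay enabled forever, and fairness would force it to be
  -- taken.
  by_contra hcon
  push Not at hcon
  obtain ⟨t', ht', he⟩ := h.progress k hk a t fun t' ht' => hen t' ht' (hcon t' ht')
  have hstep := h.step t'
  rw [he] at hstep
  refine hcon (t' + 1) (by omega) ?_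
  rw [hstep.2.2, Function.update_self]
  exact heff _

theorem hasSent_send (L : LocalState n P D) (dsts : Finset (Fin n)) (x : Payload n P D) :
    (L.send dsts x).hasSent dsts x :=
  fun _ hq => Or.inr ⟨hq, rfl⟩

/-- A packet sent is received at some time not before `t`. -/
theorem Setup.IsExecution.eventually_received (h : S.IsExecution N E) {t : ℕ} {src dst : Fin n}
    {x : Payload n P D} (hx : (dst, x) ∈ (E.state t src).out) :
    ∃ t' ≥ t, (src, x) ∈ (E.state t' dst).rcvd := by
  obtain ⟨t', ht'⟩ := h.network t src dst x hx
  exact ⟨max t t', le_max_left _ _, (h.grows (le_max_right _ _) dst).rcvd ht'⟩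

/-- An honest node that has signed a message answers requests for it. -/
theorem Setup.IsExecution.eventually_response (h : S.IsExecution N E) {k q : Fin n}
    (hq : q ∉ S.byz) {t : ℕ} {p : Msg n P D} (hp : p ∈ (E.state t q).signed)
    (hreq : (q, .request p.sender p.round false) ∈ (E.state t k).out) :
    ∃ t' ≥ t, (q, .response p) ∈ (E.state t' k).rcvd := by
  obtain ⟨t₁, ht₁, h₁⟩ := h.eventually_received hreq
  -- The request and the signed message persist, so replying stays possible until the response is
  -- out.
  obtain ⟨t₂, ht₂, h₂⟩ := h.eventually_of_enabled hq (a := .reply k false p) (t := t₁)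
    (fun L => (k, Payload.response p) ∈ L.out)
    (fun t' ht' hn => ⟨(h.grows ht' q).rcvd h₁, Or.inl ((h.grows (ht₁.trans ht') q).signed hp), hn⟩)
    (fun L => hasSent_send L {k} (.response p) k (Finset.mem_singleton_self k))
  obtain ⟨t₃, ht₃, h₃⟩ := h.eventually_received h₂
  exact ⟨t₃, ht₁.trans (ht₂.trans ht₃), h₃⟩

/-- A genuine certificate of a committee without Byzantine majority bears an honest share. -/
theorem exists_honest_signer {c : Cert n D} (hc : S.CertFormable N s c)
    (hmaj : (S.committee N c.sender c.round ∩ S.byz).card ≤ S.nc / 2) :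
    ∃ q ∈ S.committee N c.sender c.round, q ∉ S.byz ∧ ∃ m ∈ (s q).signed, S.certOf m = c := by
  classical
  by_contra hcon
  push Not at hcon
  have hle : S.threshold ≤ (S.committee N c.sender c.round ∩ S.byz).card := by
    refine le_trans hc (Finset.card_le_card ?_)
    intro q hq
    rw [Finset.mem_filter] at hq
    rw [Finset.mem_inter]
    refine ⟨hq.1, ?_⟩
    by_contra hb
    rcases hq.2 with h1 | ⟨m, hm, e⟩
    · exact hb h1
    · exact hcon q hq.1 hb m hm e
  unfold Setup.threshold at hle
  omega

/-- Collision freeness is used in this form: a certificate determines the message it certifies. -/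
theorem certOf_injective (hash_inj : Function.Injective S.hash) : Function.Injective S.certOf :=
  fun _ _ h => hash_inj (congrArg Cert.digest h)

/-- A walk leaves every position whose committee has no Byzantine majority. -/
theorem Setup.IsExecution.eventually_walked (h : S.IsExecution N E) {k : Fin n} (hk : k ∉ S.byz)
    {t : ℕ} {w : Walk n D} (hw : w ∈ (E.state t k).walks)
    (hmaj : (S.committee N w.cert.sender w.cert.round ∩ S.byz).card ≤ S.nc / 2) :
    ∃ t' ≥ t, w ∈ (E.state t' k).walked := by
  obtain ⟨q, hqc, hq, p, hp, hpc⟩ := exists_honest_signer ((h.localGenuine t k).walks w hw) hmaj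
  have hsender : p.sender = w.cert.sender := by rw [← hpc]; rfl
  have hround : p.round = w.cert.round := by rw [← hpc]; rfl
  -- Requesting and stepping are enabled only while `w` is not walked. Assuming that it never is
  -- keeps both enabled as long as needed.
  by_contra hcon
  push Not at hcon
  obtain ⟨t₁, ht₁, h₁⟩ := h.eventually_of_enabled hk (a := .walkRequest w) (t := t)
    (fun L => L.hasSent (S.committee N w.cert.sender w.cert.round)
      (.request w.cert.sender w.cert.round false))
    (fun t' ht' hn => ⟨(h.grows ht' k).walks hw, hcon t' ht', hn⟩)
    (fun L => hasSent_send L _ _)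
  obtain ⟨t₂, ht₂, h₂⟩ := h.eventually_response (k := k) hq ((h.grows ht₁ q).signed hp)
    (by rw [hsender, hround]; exact h₁ q hqc)
  obtain ⟨t₃, ht₃, h₃⟩ := h.eventually_of_enabled hk (a := .walkStep w q p) (t := t₂)
    (fun L => w ∈ L.walked)
    (fun t' ht' hn =>
      ⟨(h.grows (ht₁.trans (ht₂.trans ht')) k).walks hw, hn, (h.grows (ht₂.trans ht') k).hasSent h₁,
        hqc, (h.grows ht' k).rcvd h₂, hpc⟩)
    (fun L => by rw [effect_walkStep_walked]; exact Set.mem_insert _ _)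
  exact hcon t₃ (ht₁.trans (ht₂.trans ht₃)) h₃

/-- Given a delivered message, the walk that found it goes on to the previous round. -/
theorem Setup.IsExecution.exists_previous (h : S.IsExecution N E)
    (hash_inj : Function.Injective S.hash) {i : Fin n}
    (hmaj : ∀ r, (S.committee N i r ∩ S.byz).card ≤ S.nc / 2) {k : Fin n} {t : ℕ} {m : Msg n P D}
    (hm : m ∈ (E.state t k).delivered) (hi : m.sender = i) (hr : 1 < m.round) :
    ∃ p : Msg n P D, p.sender = i ∧ p.round = m.round - 1 ∧ m.parent = some (S.certOf p) ∧
      ∃ top, p.round ≤ top ∧ (⟨S.certOf p, top⟩ : Walk n D) ∈ (E.state t k).walks := by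
  subst hi
  obtain ⟨w, hw, hwc, htop, hnext⟩ := (h.walkSound t k).delivered m hm
  have hf := (h.localGenuine t k).walks w hw
  rw [hwc] at hf
  obtain ⟨q, -, -, m', hm', e⟩ := exists_honest_signer hf (hmaj _)
  -- The honest member signed the delivered message itself, so its check of the parent applies to
  -- this message.
  obtain rfl := certOf_injective hash_inj e
  obtain ⟨p, hp1, hp2, hp3⟩ := (h.localGenuine t q).signed_spec m' hm' hr
  -- The walk keeps its `top`, which is at least the round of the delivered message; the previous
  -- round is therefore due as well.
  refine ⟨p, hp1, by omega, hp3, w.top, by omega, hnext _ hp3 hp1 ?_ hp2⟩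
  change 1 ≤ p.round
  omega

/-- The deterministic part: without Byzantine majorities in the committees of `i`, completion is
sequential, and the chain is retrieved from the committees. -/
theorem Setup.IsExecution.sequentiality (h : S.IsExecution N E)
    (hash_inj : Function.Injective S.hash) {i : Fin n}
    (hmaj : ∀ r, (S.committee N i r ∩ S.byz).card ≤ S.nc / 2) :
    S.CompletionSequentiality E i ∧ S.ChainRetrieval N E i := by
  have key : ∀ k, k ∉ S.byz → ∀ t, ∀ m ∈ (E.state t k).delivered, m.sender = i → 1 < m.round →
      ∃ p : Msg n P D, p.sender = i ∧ p.round = m.round - 1 ∧ m.parent = some (S.certOf p) ∧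
        ∃ top, p.round ≤ top ∧ ∃ t' ≥ t,
          (⟨S.certOf p, top⟩ : Walk n D) ∈ (E.state t' k).walked := by
    intro k hk t m hm hi hr
    obtain ⟨p, hp1, hp2, hp3, top, htop, hw⟩ := h.exists_previous hash_inj hmaj hm hi hr
    refine ⟨p, hp1, hp2, hp3, top, htop, h.eventually_walked hk hw ?_⟩
    change (S.committee N p.sender p.round ∩ S.byz).card ≤ _
    rw [hp1]
    exact hmaj _
  constructor
  · intro k hk t m hm hi hr
    obtain ⟨p, rfl, hp2, -, top, htop, t', ht', hw⟩ := key k hk t m hm hi hr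
    obtain ⟨m', hm', h1, h2⟩ := ((h.walkSound t' k).walked _ hw).2.2 htop
    exact ⟨t', ht', m', hm', h1, h2.trans hp2⟩
  · intro k hk t m hm hi hr
    obtain ⟨p, rfl, hp2, hp3, top, htop, t', ht', hw⟩ := key k hk t m hm hi hr
    obtain ⟨h1, ⟨src, h2, m', h3, h4⟩, -⟩ := (h.walkSound t' k).walked _ hw
    -- The message received at this position is the predecessor `p` itself, whichever member sent
    -- it.
    obtain rfl := certOf_injective hash_inj h4
    refine ⟨m', rfl, hp2, hp3, t', ht', ?_, src, ?_, h3⟩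
    · rw [← hp2]; exact h1
    · rw [← hp2]; exact h2

end APMBRB

/-! ### The probabilistic bound and the deterministic argument combined -/

theorem mainTheorem6 {n : ℕ} {P D Ω : Type*} [MeasurableSpace Ω]
    (μ : MeasureTheory.Measure Ω) [MeasureTheory.IsProbabilityMeasure μ]
    (S : APMBRB.Setup n P D) (hash_inj : Function.Injective S.hash)
    (hbyz : S.byz.card ≤ S.f) (hf : 3 * S.f < n)
    (ε : ℝ) (hε : 0 < ε) (hφ : 1 ≤ S.φ)
    (hnc : 18 * Real.log ((S.φ : ℝ) / ε) ≤ (S.nc : ℝ))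
    (N : Ω → Fin n → ℕ → Finset (Fin n))
    (hN : ∀ j ρ, ρ < S.φ → APMBRB.IsUniformCommittee μ S.nc (fun ω => N ω j ρ))
    (E : Ω → APMBRB.Execution n P D)
    (hE : ∀ᵐ ω ∂μ, S.IsExecution (N ω) (E ω))
    (i : Fin n) :
    ∃ A : Set Ω, MeasurableSet A ∧ 1 - ENNReal.ofReal ε ≤ μ A ∧
      ∀ ω ∈ A, S.CompletionSequentiality (E ω) i ∧ S.ChainRetrieval (N ω) (E ω) i := by
  classical
  -- This event involves the committees alone, so it is measurable although `E` may depend on `ω`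
  -- arbitrarily.
  set bad : Set Ω := {ω | ∃ ρ < S.φ, S.nc / 2 < (N ω i ρ ∩ S.byz).card} with hbad
  have hbad_meas : MeasurableSet bad := by
    have h0 : bad = ⋃ ρ ∈ Finset.range S.φ, {ω | S.nc / 2 < (N ω i ρ ∩ S.byz).card} := by
      ext ω; simp [hbad]
    rw [h0]
    exact Finset.measurableSet_biUnion _ fun ρ hρ =>
      (hN i ρ (Finset.mem_range.1 hρ)).measurableSet (fun A => S.nc / 2 < (A ∩ S.byz).card)
  have hbad_le : μ bad ≤ ENNReal.ofReal ε :=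
    APMBRB.measure_exists_majority_le hε hφ hnc (hN i) S.byz (by omega)
  -- The exceptional set need not be measurable; its measurable hull is still null.
  set null : Set Ω := MeasureTheory.toMeasurable μ {ω | ¬ S.IsExecution (N ω) (E ω)} with hnull
  have hnull_zero : μ null = 0 := by
    rw [hnull, MeasureTheory.measure_toMeasurable]
    exact MeasureTheory.ae_iff.1 hE
  have hmeas : MeasurableSet (bad ∪ null) :=
    hbad_meas.union (MeasureTheory.measurableSet_toMeasurable _ _)
  refine ⟨(bad ∪ null)ᶜ, hmeas.compl, ?_, fun ω hω => ?_⟩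
  · rw [MeasureTheory.prob_compl_eq_one_sub hmeas]
    refine tsub_le_tsub_left ?_ 1
    calc μ (bad ∪ null) ≤ μ bad + μ null := MeasureTheory.measure_union_le _ _
      _ ≤ ENNReal.ofReal ε := by rw [hnull_zero, add_zero]; exact hbad_le
  · rw [Set.mem_compl_iff, Set.mem_union, not_or] at hω
    have hexec : S.IsExecution (N ω) (E ω) := by
      by_contra h
      exact hω.2 (MeasureTheory.subset_toMeasurable _ _ h)
    refine hexec.sequentiality hash_inj fun r => ?_
    by_contra h
    -- Periodicity: the `φ` residues account for the committees of all infinitely many rounds.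
    exact hω.1 ⟨r % S.φ, Nat.mod_lt _ hφ, not_le.1 h⟩
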